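/- Let $k \ge 3$. Call a non-empty connected open set $\Omega \subset \mathbb C^k$ a *Short $\mathbb C^k$* if 1. $\Omega = \bigcup_{j} U_j$ for open sets $U_1 \subset U_2 \subset \cdots$, each biholomorphic to the unit ball of $\mathbb C^k$; 2. the infinitesimal Kobayashi metric of $\Omega$ vanishes identically, i.e. for all $p \in \Omega$ and $\xi \in \mathbb C^k$, $$\inf\{\alpha > 0 : \text{there is a holomorphic } f : \Delta \to \Omega \text{ with } f(0) = p,\ \alpha f'(0) = \xi\} = 0,$$ where $\Delta \subset \mathbb C$ is the open unit disc; 3. there is a plurisubharmonic function $\varphi : \mathbb C^k \to \mathbb R$, bounded below and non-constant on $\Omega$, such that $\Omega = \{z \in \mathbb C^k : \varphi(z) < 0\}$. (In particular $\Omega$ carries a bounded non-constant plurisubharmonic function.) Then there exist $k-1$ Short $\mathbb C^k$'s $\Omega_1, \dots, \Omega_{k-1} \subset \mathbb C^k$ with $\Omega_i \cap \Omega_j = \emptyset$ for all $i \ne j$. -/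

import Mathlib

namespace ShortCk

open scoped ENNReal

/-- `U` and `V` are biholomorphic: there are mutually inverse holomorphic maps between them. -/
def Biholomorphic {k : ℕ} (U V : Set (EuclideanSpace ℂ (Fin k))) : Prop :=
  ∃ f g : EuclideanSpace ℂ (Fin k) → EuclideanSpace ℂ (Fin k),
    DifferentiableOn ℂ f U ∧ DifferentiableOn ℂ g V ∧
    Set.MapsTo f U V ∧ Set.MapsTo g V U ∧ Set.InvOn g f U V

/-- The infinitesimal Kobayashi (Royden) metric of `Ω` at `p` in the direction `ξ`: the infimum of
the `α > 0` such that some holomorphic `f` from the unit disc to `Ω` has `f 0 = p` and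
`α f'(0) = ξ`. -/
noncomputable def kobayashiMetric {k : ℕ} (Ω : Set (EuclideanSpace ℂ (Fin k)))
    (p ξ : EuclideanSpace ℂ (Fin k)) : ℝ≥0∞ :=
  ⨅ (α : ℝ) (_ : 0 < α ∧ ∃ f : ℂ → EuclideanSpace ℂ (Fin k),
      DifferentiableOn ℂ f (Metric.ball 0 1) ∧ Set.MapsTo f (Metric.ball 0 1) Ω ∧
      f 0 = p ∧ (α : ℂ) • deriv f 0 = ξ), ENNReal.ofReal α

/-- Plurisubharmonicity on `U` of a function that nowhere takes the value `-∞`: upper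
semicontinuity, and the sub-mean value inequality on every closed complex disc
`{p + ζ ξ : |ζ| ≤ 1}` inside `U`. For a finite-valued function, the inequality with the mean
computed in `[-∞, ∞)` forces the mean to be finite; this is the integrability clause. -/
def PlurisubharmonicOn {k : ℕ} (φ : EuclideanSpace ℂ (Fin k) → ℝ)
    (U : Set (EuclideanSpace ℂ (Fin k))) : Prop :=
  UpperSemicontinuousOn φ U ∧
  ∀ p ξ : EuclideanSpace ℂ (Fin k), (∀ ζ : ℂ, ‖ζ‖ ≤ 1 → p + ζ • ξ ∈ U) →
    CircleIntegrable (fun ζ : ℂ => φ (p + ζ • ξ)) 0 1 ∧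
    φ p ≤ Real.circleAverage (fun ζ : ℂ => φ (p + ζ • ξ)) 0 1

/-- A Short `ℂ^k`: a domain in `ℂ^k` that is an increasing union of domains biholomorphic to the
unit ball, whose infinitesimal Kobayashi metric vanishes identically, and that is the sublevel set
`{φ < 0}` of a plurisubharmonic function on `ℂ^k` which is bounded below and not constant on the
domain. In particular the domain carries a bounded nonconstant plurisubharmonic function. -/
structure IsShort {k : ℕ} (Ω : Set (EuclideanSpace ℂ (Fin k))) : Prop where
  isOpen : IsOpen Ω
  isConnected : IsConnected Ω
  exhaustion : ∃ U : ℕ → Set (EuclideanSpace ℂ (Fin k)),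
    (∀ j, IsOpen (U j)) ∧ (∀ j, U j ⊆ U (j + 1)) ∧
    (∀ j, Biholomorphic (U j) (Metric.ball 0 1)) ∧ Ω = ⋃ j, U j
  kobayashi_eq_zero : ∀ p ∈ Ω, ∀ ξ, kobayashiMetric Ω p ξ = 0
  sublevel : ∃ φ : EuclideanSpace ℂ (Fin k) → ℝ,
    PlurisubharmonicOn φ Set.univ ∧ (∃ c : ℝ, ∀ z, c ≤ φ z) ∧
    Ω = {z | φ z < 0} ∧ ∃ z ∈ Ω, ∃ w ∈ Ω, φ z ≠ φ w

end ShortCk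

/-!
Following Fornæss, let `F 0, F 1, …` be automorphisms of `ℂᵏ` such that `F n` at most squares the
norm outside a ball of radius `a ^ 2 ^ n`. Its basin of attraction of the origin is the increasing
union of the preimages of the unit ball under the compositions `F (n - 1) ∘ ⋯ ∘ F 0`. These
compositions and their derivatives tend to `0` locally uniformly on the basin, so their inverses map
ever larger discs, relative to the image of a tangent vector, into it: the Kobayashi metric
vanishes. The limit of the functions `2⁻ⁿ log (max ‖F (n - 1) ∘ ⋯ ∘ F 0‖ (a ^ 2 ^ n))` is
plurisubharmonic, defines the basin, and is nonconstant as soon as some orbit decays no faster than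
`b ^ 2 ^ n` with `b > a`.

For small perturbations of the map squaring all coordinates but the last, a point with a large
coordinate off the last axis that dominates the last coordinate escapes to infinity. The basin
therefore lies in a cone around the last axis. Being Short is invariant under affine automorphisms,
and for `k ≥ 3` two coordinate directions are transverse to the last axis: shearing the cone in one
of them separates its copies near infinity, and translating in the other separates them near the
origin. This produces infinitely many disjoint copies.
-/

namespace ShortCk

open Set Filter Topology Metric MeasureTheory Real

section SubmeanValue

lemma log_norm_le_circleAverage {f : ℂ → ℂ} {c : ℂ} {R : ℝ}
    (hf : AnalyticOnNhd ℂ f (closedBall c |R|)) (hfc : f c ≠ 0) :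
    log ‖f c‖ ≤ circleAverage (fun z => log ‖f z‖) c R := by
  rcases eq_or_ne R 0 with rfl | hR
  · rw [circleAverage_zero]
  rw [hf.circleAverage_log_norm hR hfc]
  refine le_add_of_nonneg_left (finsum_nonneg fun u => ?_)
  by_cases hu : u ∈ closedBall c |R|
  · refine mul_nonneg (mod_cast MeromorphicOn.AnalyticOnNhd.divisor_nonneg hf u) ?_
    rcases eq_or_ne c u with rfl | hcu
    · simp
    have hpos : 0 < ‖c - u‖ := norm_pos_iff.2 (sub_ne_zero.2 hcu)
    rw [← log_abs, abs_mul, abs_inv, abs_norm]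
    refine log_nonneg ((one_le_div hpos).2 ?_)
    rwa [← dist_eq_norm, ← mem_closedBall']
  · simp [Function.locallyFinsuppWithin.apply_eq_zero_of_notMem _ hu]

variable {E : Type*} [NormedAddCommGroup E]

lemma circleIntegrable_posLog_norm {g : ℂ → E} {s : Set ℂ} {c : ℂ} {R : ℝ}
    (hg : ContinuousOn g s) (hcs : closedBall c |R| ⊆ s) :
    CircleIntegrable (fun z => log⁺ ‖g z‖) c R :=
  (continuous_posLog.comp_continuousOn
    (hg.mono (sphere_subset_closedBall.trans hcs)).norm).circleIntegrable'

variable [NormedSpace ℂ E]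

lemma posLog_norm_le_circleAverage {g : ℂ → E} {s : Set ℂ} {c : ℂ} {R : ℝ} (hs : IsOpen s)
    (hg : DifferentiableOn ℂ g s) (hcs : closedBall c |R| ⊆ s) :
    log⁺ ‖g c‖ ≤ circleAverage (fun z => log⁺ ‖g z‖) c R := by
  rcases le_or_gt ‖g c‖ 1 with hgc | hgc
  · rw [(posLog_eq_zero_iff _).2 (by rwa [abs_norm])]
    exact circleAverage_nonneg_of_nonneg fun _ _ => posLog_nonneg
  -- A norming functional at `g c` reduces the claim to a scalar function not vanishing at `c`.
  obtain ⟨l, hl, hlc⟩ := exists_dual_vector'' ℂ (g c)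
  have hlc' : ‖l (g c)‖ = ‖g c‖ := by simp [hlc]
  have hlg : AnalyticOnNhd ℂ (l ∘ g) (closedBall c |R|) := fun z hz =>
    (l.differentiable.comp_differentiableOn hg).analyticAt (hs.mem_nhds (hcs hz))
  have hle : ∀ z, log ‖l (g z)‖ ≤ log⁺ ‖g z‖ := fun z =>
    (le_max_right _ _).trans (posLog_le_posLog (norm_nonneg _) (by
      simpa using l.le_of_opNorm_le hl (g z)))
  calc log⁺ ‖g c‖ = log ‖l (g c)‖ := by rw [hlc', posLog_eq_log (by simpa using hgc.le)]
    _ ≤ circleAverage (fun z => log ‖l (g z)‖) c R :=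
      log_norm_le_circleAverage hlg (norm_pos_iff.1 (by rw [Function.comp, hlc']; linarith))
    _ ≤ circleAverage (fun z => log⁺ ‖g z‖) c R :=
      circleAverage_mono
        (hlg.meromorphicOn.mono_set sphere_subset_closedBall).circleIntegrable_log_norm
        (circleIntegrable_posLog_norm hg.continuousOn hcs) fun z _ => hle z

end SubmeanValue

section Plurisubharmonic

variable {k l : ℕ} {U : Set (EuclideanSpace ℂ (Fin k))}
  {φ : EuclideanSpace ℂ (Fin k) → ℝ}

lemma plurisubharmonicOn_posLog_norm {E : Type*} [NormedAddCommGroup E] [NormedSpace ℂ E]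
    {G : EuclideanSpace ℂ (Fin k) → E} (hU : IsOpen U) (hG : DifferentiableOn ℂ G U) :
    PlurisubharmonicOn (fun x => log⁺ ‖G x‖) U := by
  refine ⟨(continuous_posLog.comp_continuousOn hG.continuousOn.norm).upperSemicontinuousOn,
    fun p ξ hpξ => ?_⟩
  have hline : Differentiable ℂ fun ζ : ℂ => p + ζ • ξ := by fun_prop
  have hsub : closedBall (0 : ℂ) |1| ⊆ (fun ζ : ℂ => p + ζ • ξ) ⁻¹' U := fun ζ hζ =>
    hpξ ζ (by simpa using hζ)
  have hGline := hG.comp hline.differentiableOn (mapsTo_preimage _ _)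
  exact ⟨circleIntegrable_posLog_norm hGline.continuousOn hsub,
    by simpa using posLog_norm_le_circleAverage (hU.preimage hline.continuous) hGline hsub⟩

lemma PlurisubharmonicOn.const_add (hφ : PlurisubharmonicOn φ U) (c : ℝ) :
    PlurisubharmonicOn (fun x => c + φ x) U := by
  refine ⟨(continuous_const_add c).comp_upperSemicontinuousOn hφ.1 (add_right_mono),
    fun p ξ hpξ => ?_⟩
  obtain ⟨hint, hmean⟩ := hφ.2 p ξ hpξ
  refine ⟨(circleIntegrable_const c 0 1).add hint, ?_⟩
  rw [circleAverage_fun_add (circleIntegrable_const c 0 1) hint, circleAverage_const]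
  exact add_le_add_right hmean c

lemma PlurisubharmonicOn.const_mul (hφ : PlurisubharmonicOn φ U) {c : ℝ} (hc : 0 ≤ c) :
    PlurisubharmonicOn (fun x => c * φ x) U := by
  refine ⟨(continuous_const_mul c).comp_upperSemicontinuousOn hφ.1
    (monotone_mul_left_of_nonneg hc), fun p ξ hpξ => ?_⟩
  obtain ⟨hint, hmean⟩ := hφ.2 p ξ hpξ
  refine ⟨hint.const_smul (a := c), ?_⟩
  simp only [← smul_eq_mul]
  rw [circleAverage_fun_smul]
  exact smul_le_smul_of_nonneg_left hmean hc

lemma plurisubharmonicOn_log_max_norm {E : Type*} [NormedAddCommGroup E] [NormedSpace ℂ E]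
    {G : EuclideanSpace ℂ (Fin k) → E} (hU : IsOpen U) (hG : DifferentiableOn ℂ G U) {r : ℝ}
    (hr : 0 < r) : PlurisubharmonicOn (fun x => log (max ‖G x‖ r)) U := by
  have hlog : ∀ x, log (max ‖G x‖ r) = log r + log⁺ ‖(r⁻¹ : ℂ) • G x‖ := fun x => by
    rw [posLog_eq_log_max_one (norm_nonneg _), ← log_mul hr.ne' (by positivity),
      mul_max_of_nonneg _ _ hr.le, mul_one, norm_smul, norm_inv, Complex.norm_real,
      norm_of_nonneg hr.le, mul_inv_cancel_left₀ hr.ne', max_comm]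
  simpa only [hlog] using
    (plurisubharmonicOn_posLog_norm hU (hG.fun_const_smul (r⁻¹ : ℂ))).const_add (log r)

lemma PlurisubharmonicOn.comp_affineMap {V : Set (EuclideanSpace ℂ (Fin l))}
    {ψ : EuclideanSpace ℂ (Fin l) → ℝ} (hψ : PlurisubharmonicOn ψ V)
    (T : EuclideanSpace ℂ (Fin k) →ᵃ[ℂ] EuclideanSpace ℂ (Fin l)) :
    PlurisubharmonicOn (ψ ∘ T) (T ⁻¹' V) := by
  refine ⟨hψ.1.comp T.continuous_of_finiteDimensional.continuousOn (mapsTo_preimage T V),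
    fun p ξ hpξ => ?_⟩
  have hT : ∀ ζ : ℂ, T (p + ζ • ξ) = T p + ζ • T.linear ξ := fun ζ => by
    rw [add_comm, ← vadd_eq_add, T.map_vadd, map_smul, vadd_eq_add, add_comm]
  simpa only [Function.comp, hT] using
    hψ.2 (T p) (T.linear ξ) fun ζ hζ => hT ζ ▸ hpξ ζ hζ

lemma PlurisubharmonicOn.iInf_of_antitone {u : ℕ → EuclideanSpace ℂ (Fin k) → ℝ} {c : ℝ}
    (hu : ∀ n, PlurisubharmonicOn (u n) U) (hanti : Antitone u) (hc : ∀ n, ∀ x ∈ U, c ≤ u n x) :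
    PlurisubharmonicOn (fun x => ⨅ n, u n x) U := by
  have hbdd : ∀ x ∈ U, BddBelow (range fun n => u n x) := fun x hx =>
    ⟨c, forall_mem_range.2 fun n => hc n x hx⟩
  have hlim : ∀ x ∈ U, Tendsto (fun n => u n x) atTop (𝓝 (⨅ n, u n x)) := fun x hx =>
    tendsto_atTop_ciInf (fun _ _ h => hanti h x) (hbdd x hx)
  refine ⟨upperSemicontinuousOn_ciInf hbdd fun n => (hu n).1, fun p ξ hpξ => ?_⟩
  have hcircle : ∀ θ, p + circleMap 0 1 θ • ξ ∈ U := fun θ => hpξ _ (by simp)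
  have hint := fun n => ((hu n).2 p ξ hpξ).1
  let b : ℝ → ℝ := fun θ => |c| + |u 0 (p + circleMap 0 1 θ • ξ)|
  have hb : IntervalIntegrable b volume 0 (2 * π) := intervalIntegrable_const.add (hint 0).abs
  have hub : ∀ n θ, ‖u n (p + circleMap 0 1 θ • ξ)‖ ≤ b θ := fun n θ =>
    (abs_le_max_abs_abs (hc n _ (hcircle θ)) (hanti n.zero_le _)).trans
      (max_le_add_of_nonneg (abs_nonneg _) (abs_nonneg _))
  have hcirclelim := fun θ => hlim _ (hcircle θ)
  have hmeas := fun n => (hint n).def'.aestronglyMeasurable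
  constructor
  · refine hb.mono_fun (aestronglyMeasurable_of_tendsto_ae atTop hmeas (ae_of_all _ hcirclelim))
      (ae_of_all _ fun θ => ?_)
    exact (le_of_tendsto (hcirclelim θ).norm (Eventually.of_forall (hub · θ))).trans
      (le_abs_self _)
  · have havg : Tendsto (fun n => circleAverage (fun ζ => u n (p + ζ • ξ)) 0 1) atTop
        (𝓝 (circleAverage (fun ζ => ⨅ n, u n (p + ζ • ξ)) 0 1)) :=
      (intervalIntegral.tendsto_integral_filter_of_dominated_convergence b
        (Eventually.of_forall hmeas)
        (Eventually.of_forall fun n => ae_of_all _ fun θ _ => hub n θ)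
        hb (ae_of_all _ fun θ _ => hcirclelim θ)).const_smul _
    have hp : p ∈ U := by simpa using hpξ 0 (by simp)
    exact ge_of_tendsto havg (Eventually.of_forall fun n =>
      (ciInf_le (hbdd p hp) n).trans ((hu n).2 p ξ hpξ).2)

end Plurisubharmonic


section HolomorphicAut

variable {E : Type*} [NormedAddCommGroup E] [NormedSpace ℂ E] {e f : E ≃ E}

/-- A permutation `e` of `E` is a holomorphic automorphism: `e` and its inverse are entire. -/
structure IsHolomorphicAut (e : E ≃ E) : Prop where
  differentiable : Differentiable ℂ e
  differentiable_symm : Differentiable ℂ e.symm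

lemma isHolomorphicAut_refl : IsHolomorphicAut (Equiv.refl E) :=
  ⟨differentiable_id, differentiable_id⟩

lemma IsHolomorphicAut.trans (he : IsHolomorphicAut e) (hf : IsHolomorphicAut f) :
    IsHolomorphicAut (e.trans f) :=
  ⟨hf.differentiable.comp he.differentiable, he.differentiable_symm.comp hf.differentiable_symm⟩

lemma isHolomorphicAut_affineEquiv [FiniteDimensional ℂ E] (T : E ≃ᵃ[ℂ] E) :
    IsHolomorphicAut T.toEquiv :=
  ⟨(T.toContinuousAffineEquiv : E →ᴬ[ℂ] E).differentiable,
    (T.symm.toContinuousAffineEquiv : E →ᴬ[ℂ] E).differentiable⟩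

lemma IsHolomorphicAut.isOpen_preimage (he : IsHolomorphicAut e) {V : Set E} (hV : IsOpen V) :
    IsOpen (e ⁻¹' V) :=
  hV.preimage he.differentiable.continuous

lemma IsHolomorphicAut.isConnected_preimage (he : IsHolomorphicAut e) {V : Set E}
    (hV : IsConnected V) : IsConnected (e ⁻¹' V) := by
  rw [← e.image_symm_eq_preimage]
  exact hV.image _ he.differentiable_symm.continuous.continuousOn

variable {k : ℕ} {U V W : Set (EuclideanSpace ℂ (Fin k))}

lemma Biholomorphic.trans (h₁ : Biholomorphic U V) (h₂ : Biholomorphic V W) :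
    Biholomorphic U W := by
  obtain ⟨f, g, hf, hg, hfU, hgV, hfg⟩ := h₁
  obtain ⟨f', g', hf', hg', hfV, hgW, hfg'⟩ := h₂
  exact ⟨f' ∘ f, g ∘ g', hf'.comp hf hfU, hg.comp hg' hgW, hfV.comp hfU, hgV.comp hgW,
    hfg.comp hfg' hfU hgW⟩

lemma IsHolomorphicAut.biholomorphic_preimage
    {e : EuclideanSpace ℂ (Fin k) ≃ EuclideanSpace ℂ (Fin k)} (he : IsHolomorphicAut e)
    (V : Set (EuclideanSpace ℂ (Fin k))) : Biholomorphic (e ⁻¹' V) V :=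
  ⟨e, e.symm, he.differentiable.differentiableOn, he.differentiable_symm.differentiableOn,
    mapsTo_preimage e V, fun y hy => by simpa using hy,
    fun x _ => e.symm_apply_apply x, fun y _ => e.apply_symm_apply y⟩

end HolomorphicAut

section KobayashiMetric

variable {k l : ℕ} {Ω V : Set (EuclideanSpace ℂ (Fin k))} {p ξ : EuclideanSpace ℂ (Fin k)}

lemma kobayashiMetric_map_le {Ω' : Set (EuclideanSpace ℂ (Fin l))}
    {f : EuclideanSpace ℂ (Fin k) → EuclideanSpace ℂ (Fin l)} (hΩ : IsOpen Ω)
    (hf : DifferentiableOn ℂ f Ω) (hfΩ : MapsTo f Ω Ω') :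
    kobayashiMetric Ω' (f p) (fderiv ℂ f p ξ) ≤ kobayashiMetric Ω p ξ := by
  refine le_iInf₂ fun α ⟨hα, g, hg, hgΩ, hg0, hgξ⟩ => iInf₂_le α ⟨hα, f ∘ g, hf.comp hg hgΩ,
    hfΩ.comp hgΩ, by rw [Function.comp, hg0], ?_⟩
  have h0 : (0 : ℂ) ∈ ball 0 1 := mem_ball_self one_pos
  have hfp : HasFDerivAt f (fderiv ℂ f p) (g 0) :=
    hg0 ▸ (hf.differentiableAt (hΩ.mem_nhds (hg0 ▸ hgΩ h0))).hasFDerivAt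
  have hg' : HasDerivAt g (deriv g 0) 0 :=
    (hg.differentiableAt (isOpen_ball.mem_nhds h0)).hasDerivAt
  rw [(hfp.comp_hasDerivAt 0 hg').deriv, ← hgξ, map_smul]

lemma IsHolomorphicAut.kobayashiMetric_le_of_preimage_subset
    {e : EuclideanSpace ℂ (Fin k) ≃ EuclideanSpace ℂ (Fin k)} (he : IsHolomorphicAut e)
    (hV : IsOpen V) (hVΩ : e ⁻¹' V ⊆ Ω) :
    kobayashiMetric Ω p ξ ≤ kobayashiMetric V (e p) (fderiv ℂ e p ξ) := by
  have hmaps : MapsTo e.symm V Ω := fun y hy => hVΩ (by simpa using hy)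
  have hinv : fderiv ℂ e.symm (e p) (fderiv ℂ e p ξ) = ξ := by
    rw [← ContinuousLinearMap.comp_apply, ← fderiv_comp p (he.differentiable_symm _)
      (he.differentiable _), e.symm_comp_self, fderiv_id, ContinuousLinearMap.id_apply]
  simpa only [e.symm_apply_apply, hinv] using
    kobayashiMetric_map_le (p := e p) (ξ := fderiv ℂ e p ξ) hV
      he.differentiable_symm.differentiableOn hmaps

lemma kobayashiMetric_le_of_ball_subset {r α : ℝ} (hα : 0 < α) (hr : ball p r ⊆ Ω)
    (hξ : ‖ξ‖ < α * r) : kobayashiMetric Ω p ξ ≤ ENNReal.ofReal α := by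
  have hf : ∀ ζ, HasDerivAt (fun ζ : ℂ => p + ζ • (α⁻¹ : ℂ) • ξ) ((α⁻¹ : ℂ) • ξ) ζ := fun ζ => by
    simpa only [id, one_smul] using
      ((hasDerivAt_id ζ).smul_const ((α⁻¹ : ℂ) • ξ)).const_add p
  refine iInf₂_le α ⟨hα, _, fun ζ _ => (hf ζ).differentiableAt.differentiableWithinAt,
    fun ζ hζ => hr ?_, by simp, ?_⟩
  · rw [mem_ball_iff_norm, add_sub_cancel_left, norm_smul, norm_smul, norm_inv, Complex.norm_real,
      Real.norm_of_nonneg hα.le]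
    calc ‖ζ‖ * (α⁻¹ * ‖ξ‖) ≤ α⁻¹ * ‖ξ‖ :=
          mul_le_of_le_one_left (by positivity) (mem_ball_zero_iff.1 hζ).le
      _ < r := (inv_mul_lt_iff₀ hα).2 hξ
  · rw [(hf 0).deriv, smul_inv_smul₀ (mod_cast hα.ne')]

end KobayashiMetric

section Superattracting

variable {E : Type*} [NormedAddCommGroup E]

/-- The composition `F (n - 1) ∘ ⋯ ∘ F 0` of the first `n` maps of the sequence `F`. -/
def flow (F : ℕ → E ≃ E) : ℕ → E ≃ E
  | 0 => Equiv.refl E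
  | n + 1 => (flow F n).trans (F n)

/-- The basin of attraction of the origin for the non-autonomous dynamical system `F`. -/
def basin (F : ℕ → E ≃ E) : Set E := {x | Tendsto (fun n => flow F n x) atTop (𝓝 0)}

/-- The norm of the `n`-th point of the orbit of `x`, truncated from below at `a ^ 2 ^ n` in order
to have a finite logarithm comparable to `2 ^ n`. -/
def orbitSize (F : ℕ → E ≃ E) (a : ℝ) (n : ℕ) (x : E) : ℝ := max ‖flow F n x‖ (a ^ 2 ^ n)

/-- The finite stages `2⁻ⁿ log` of the size of the orbit, decreasing to `green`. -/
noncomputable def potential (F : ℕ → E ≃ E) (a : ℝ) (n : ℕ) (x : E) : ℝ :=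
  (2 ^ n)⁻¹ * log (orbitSize F a n x)

/-- The Green function of the basin of `F`, measuring the exponential rate at which orbits
approach the origin. The truncation in `orbitSize` bounds it below by `log a`. -/
noncomputable def green (F : ℕ → E ≃ E) (a : ℝ) (x : E) : ℝ := ⨅ n, potential F a n x

lemma log_le_potential_of_pow_le {F : ℕ → E ≃ E} {a b : ℝ} {n : ℕ} {x : E} (hb : 0 < b)
    (h : b ^ 2 ^ n ≤ orbitSize F a n x) : log b ≤ potential F a n x := by
  rw [potential, ← div_eq_inv_mul, le_div_iff₀' (by positivity)]
  calc 2 ^ n * log b = log (b ^ 2 ^ n) := by rw [log_pow]; push_cast; rfl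
    _ ≤ log (orbitSize F a n x) := log_le_log (by positivity) h

variable [NormedSpace ℂ E]

/-- The sequence `F` of holomorphic automorphisms is superattracting at the origin, at rate `a`:
outside the ball of radius `a ^ 2 ^ n`, the map `F n` at most squares the norm. -/
structure IsSuperattracting (F : ℕ → E ≃ E) (a : ℝ) : Prop where
  pos : 0 < a
  lt_one : a < 1
  isHolomorphicAut : ∀ n, IsHolomorphicAut (F n)
  norm_le : ∀ n x, ‖F n x‖ ≤ max ‖x‖ (a ^ 2 ^ n) ^ 2

namespace IsSuperattracting

variable {F : ℕ → E ≃ E} {a : ℝ}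

lemma isHolomorphicAut_flow (hF : IsSuperattracting F a) (n : ℕ) :
    IsHolomorphicAut (flow F n) := by
  induction n with
  | zero => exact isHolomorphicAut_refl
  | succ n ih => exact ih.trans (hF.isHolomorphicAut n)

lemma orbitSize_pos (hF : IsSuperattracting F a) (n : ℕ) (x : E) : 0 < orbitSize F a n x :=
  lt_max_of_lt_right (pow_pos hF.pos _)

lemma orbitSize_lt_one_iff (hF : IsSuperattracting F a) {n : ℕ} {x : E} :
    orbitSize F a n x < 1 ↔ ‖flow F n x‖ < 1 := by
  rw [orbitSize, max_lt_iff, and_iff_left (pow_lt_one₀ hF.pos.le hF.lt_one (by positivity))]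

lemma orbitSize_succ_le (hF : IsSuperattracting F a) (n : ℕ) (x : E) :
    orbitSize F a (n + 1) x ≤ orbitSize F a n x ^ 2 := by
  refine max_le (hF.norm_le n _) ?_
  rw [pow_succ, pow_mul]
  exact pow_le_pow_left₀ (pow_nonneg hF.pos.le _) (le_max_right _ _) 2

lemma orbitSize_add_le (hF : IsSuperattracting F a) (n j : ℕ) (x : E) :
    orbitSize F a (n + j) x ≤ orbitSize F a n x ^ 2 ^ j := by
  induction j with
  | zero => simp
  | succ j ih =>
    calc orbitSize F a (n + j + 1) x ≤ orbitSize F a (n + j) x ^ 2 := hF.orbitSize_succ_le _ x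
      _ ≤ (orbitSize F a n x ^ 2 ^ j) ^ 2 := pow_le_pow_left₀ (hF.orbitSize_pos _ x).le ih 2
      _ = orbitSize F a n x ^ 2 ^ (j + 1) := by rw [← pow_mul, pow_succ]

lemma continuous_orbitSize (hF : IsSuperattracting F a) (n : ℕ) :
    Continuous (orbitSize F a n) :=
  (hF.isHolomorphicAut_flow n).differentiable.continuous.norm.max continuous_const

lemma tendstoUniformlyOn_flow (hF : IsSuperattracting F a) (n : ℕ) {q : ℝ}
    (hq₀ : 0 ≤ q) (hq : q < 1) :
    TendstoUniformlyOn (fun j => flow F (n + j)) 0 atTop {x | orbitSize F a n x ≤ q} := by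
  refine Metric.tendstoUniformlyOn_iff.2 fun ε hε => ?_
  have hpow : Tendsto (fun j : ℕ => q ^ 2 ^ j) atTop (𝓝 0) :=
    (tendsto_pow_atTop_nhds_zero_of_lt_one hq₀ hq).comp
      (tendsto_pow_atTop_atTop_of_one_lt one_lt_two)
  filter_upwards [hpow.eventually_lt_const hε] with j hj x hx
  calc dist ((0 : E → E) x) (flow F (n + j) x) = ‖flow F (n + j) x‖ := dist_zero_left _
    _ ≤ orbitSize F a (n + j) x := le_max_left _ _
    _ ≤ orbitSize F a n x ^ 2 ^ j := hF.orbitSize_add_le n j x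
    _ ≤ q ^ 2 ^ j := pow_le_pow_left₀ (hF.orbitSize_pos n x).le hx _
    _ < ε := hj

lemma mem_basin_iff (hF : IsSuperattracting F a) {x : E} :
    x ∈ basin F ↔ ∃ n, ‖flow F n x‖ < 1 := by
  refine ⟨fun hx => ((tendsto_zero_iff_norm_tendsto_zero.1 hx).eventually_lt_const one_pos).exists,
    fun ⟨n, hn⟩ => ?_⟩
  have hlim := (hF.tendstoUniformlyOn_flow n (hF.orbitSize_pos n x).le
    (hF.orbitSize_lt_one_iff.2 hn)).tendsto_at (x := x) (by simp)
  exact (tendsto_add_atTop_iff_nat n).1 (by simpa only [add_comm n, Pi.zero_apply] using hlim)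

lemma basin_eq_iUnion (hF : IsSuperattracting F a) :
    basin F = ⋃ n, flow F n ⁻¹' ball 0 1 := by
  ext x
  simp only [hF.mem_basin_iff, mem_iUnion, mem_preimage, mem_ball_zero_iff]

lemma preimage_ball_subset_basin (hF : IsSuperattracting F a) (n : ℕ) :
    flow F n ⁻¹' ball 0 1 ⊆ basin F :=
  hF.basin_eq_iUnion ▸ subset_iUnion (fun n => flow F n ⁻¹' ball 0 1) n

lemma monotone_preimage_ball (hF : IsSuperattracting F a) :
    Monotone fun n => flow F n ⁻¹' ball 0 1 := by
  refine monotone_nat_of_le_succ fun n x hx => ?_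
  rw [mem_preimage, mem_ball_zero_iff, ← hF.orbitSize_lt_one_iff] at hx ⊢
  exact (hF.orbitSize_succ_le n x).trans_lt (pow_lt_one₀ (hF.orbitSize_pos n x).le hx two_ne_zero)

lemma isOpen_preimage_ball (hF : IsSuperattracting F a) (n : ℕ) :
    IsOpen (flow F n ⁻¹' ball 0 1) :=
  (hF.isHolomorphicAut_flow n).isOpen_preimage isOpen_ball

lemma isOpen_basin (hF : IsSuperattracting F a) : IsOpen (basin F) :=
  hF.basin_eq_iUnion ▸ isOpen_iUnion hF.isOpen_preimage_ball

lemma isConnected_basin (hF : IsSuperattracting F a) : IsConnected (basin F) := by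
  let _ := NormedSpace.restrictScalars ℝ ℂ E
  have hconn : ∀ n, IsConnected (flow F n ⁻¹' ball 0 1) := fun n =>
    (hF.isHolomorphicAut_flow n).isConnected_preimage (isConnected_ball one_pos)
  have hzero : ∀ n, (0 : E) ∈ flow F n ⁻¹' ball 0 1 := fun n =>
    hF.monotone_preimage_ball n.zero_le (mem_ball_self one_pos)
  rw [hF.basin_eq_iUnion]
  exact ⟨⟨0, mem_iUnion.2 ⟨0, hzero 0⟩⟩,
    isPreconnected_iUnion ⟨0, mem_iInter.2 hzero⟩ fun n => (hconn n).isPreconnected⟩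

lemma tendstoLocallyUniformlyOn_flow (hF : IsSuperattracting F a) :
    TendstoLocallyUniformlyOn (fun n => flow F n) 0 atTop (basin F) := by
  refine Metric.tendstoLocallyUniformlyOn_iff.2 fun ε hε x hx => ?_
  obtain ⟨n, hn⟩ := hF.mem_basin_iff.1 hx
  obtain ⟨q, hnq, hq⟩ := exists_between (hF.orbitSize_lt_one_iff.2 hn)
  have hnhds : {y | orbitSize F a n y ≤ q} ∈ 𝓝 x :=
    (hF.continuous_orbitSize n).continuousAt.eventually_le_const hnq
  refine ⟨_, mem_nhdsWithin_of_mem_nhds hnhds, ?_⟩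
  have hlim := Metric.tendstoUniformlyOn_iff.1 (hF.tendstoUniformlyOn_flow n
    ((hF.orbitSize_pos n x).trans hnq).le hq) ε hε
  rw [← map_add_atTop_eq_nat n]
  simpa only [eventually_map, add_comm n] using hlim

lemma tendsto_fderiv_flow [CompleteSpace E] (hF : IsSuperattracting F a) {p : E} (hp : p ∈ basin F)
    (ξ : E) : Tendsto (fun n => fderiv ℂ (flow F n) p ξ) atTop (𝓝 0) := by
  have hline : ∀ ζ : ℂ, HasDerivAt (fun ζ : ℂ => p + ζ • ξ) ξ ζ := fun ζ => by
    simpa only [id, one_smul] using ((hasDerivAt_id ζ).smul_const ξ).const_add p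
  have hcont : Continuous fun ζ : ℂ => p + ζ • ξ := by fun_prop
  have hflow := fun n => (hF.isHolomorphicAut_flow n).differentiable
  have hderiv : ∀ n, deriv (flow F n ∘ fun ζ : ℂ => p + ζ • ξ) 0 = fderiv ℂ (flow F n) p ξ :=
    fun n => by
      rw [((hflow n _).hasFDerivAt.comp_hasDerivAt 0 (hline 0)).deriv, zero_smul, add_zero]
  have hlim := ((hF.tendstoLocallyUniformlyOn_flow.comp _ (mapsTo_preimage _ _)
    hcont.continuousOn).deriv (Eventually.of_forall fun n =>
      ((hflow n).comp fun ζ => (hline ζ).differentiableAt).differentiableOn)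
    (hF.isOpen_basin.preimage hcont)).tendsto_at (a := 0) (by simpa using hp)
  simpa [← hderiv, Function.comp_def] using hlim

lemma antitone_potential (hF : IsSuperattracting F a) : Antitone (potential F a) := by
  refine antitone_nat_of_succ_le fun n x => ?_
  calc (2 ^ (n + 1))⁻¹ * log (orbitSize F a (n + 1) x)
      ≤ (2 ^ (n + 1))⁻¹ * log (orbitSize F a n x ^ 2) := by
        gcongr
        exacts [hF.orbitSize_pos _ x, hF.orbitSize_succ_le n x]
    _ = (2 ^ n)⁻¹ * log (orbitSize F a n x) := by rw [log_pow, pow_succ]; push_cast; field_simp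

lemma log_le_potential (hF : IsSuperattracting F a) (n : ℕ) (x : E) :
    log a ≤ potential F a n x :=
  log_le_potential_of_pow_le hF.pos (le_max_right _ _)

lemma bddBelow_potential (hF : IsSuperattracting F a) (x : E) :
    BddBelow (range fun n => potential F a n x) :=
  ⟨log a, forall_mem_range.2 fun n => hF.log_le_potential n x⟩

lemma green_zero_le (hF : IsSuperattracting F a) : green F a 0 ≤ log a := by
  refine (ciInf_le (hF.bddBelow_potential 0) 0).trans_eq ?_
  simp [potential, orbitSize, flow, hF.pos.le]

lemma green_neg_iff (hF : IsSuperattracting F a) {x : E} : green F a x < 0 ↔ x ∈ basin F := by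
  have hpot : ∀ n, potential F a n x < 0 ↔ ‖flow F n x‖ < 1 := fun n => by
    rw [potential, ← div_eq_inv_mul, div_lt_iff₀ (by positivity), zero_mul,
      log_neg_iff (hF.orbitSize_pos n x), hF.orbitSize_lt_one_iff]
  simp only [hF.mem_basin_iff, ← hpot]
  exact ⟨exists_lt_of_ciInf_lt, fun ⟨n, hn⟩ => (ciInf_le (hF.bddBelow_potential x) n).trans_lt hn⟩

variable {k : ℕ} {F : ℕ → EuclideanSpace ℂ (Fin k) ≃ EuclideanSpace ℂ (Fin k)}

lemma plurisubharmonicOn_green (hF : IsSuperattracting F a) :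
    PlurisubharmonicOn (green F a) univ :=
  .iInf_of_antitone (fun n => (plurisubharmonicOn_log_max_norm isOpen_univ
      (hF.isHolomorphicAut_flow n).differentiable.differentiableOn (pow_pos hF.pos _)).const_mul
    (by positivity)) hF.antitone_potential fun n x _ => hF.log_le_potential n x

lemma kobayashiMetric_basin (hF : IsSuperattracting F a) {p : EuclideanSpace ℂ (Fin k)}
    (hp : p ∈ basin F) (ξ : EuclideanSpace ℂ (Fin k)) : kobayashiMetric (basin F) p ξ = 0 := by
  refine le_antisymm (ENNReal.le_of_forall_pos_le_add fun α hα _ => ?_) zero_le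
  rw [zero_add, ← ENNReal.ofReal_coe_nnreal]
  have hα' : (0 : ℝ) < α := hα
  have hpoint : ∀ᶠ n in atTop, ‖flow F n p‖ < 1 / 2 :=
    (tendsto_zero_iff_norm_tendsto_zero.1 hp).eventually_lt_const (by norm_num)
  have hvector : ∀ᶠ n in atTop, ‖fderiv ℂ (flow F n) p ξ‖ < α * (1 / 2) :=
    (tendsto_zero_iff_norm_tendsto_zero.1 (hF.tendsto_fderiv_flow hp ξ)).eventually_lt_const
      (by positivity)
  obtain ⟨n, hnp, hnξ⟩ := (hpoint.and hvector).exists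
  have hball : ball (flow F n p) (1 / 2) ⊆ ball 0 1 :=
    ball_subset_ball' (by rw [dist_zero_right]; linarith)
  exact ((hF.isHolomorphicAut_flow n).kobayashiMetric_le_of_preimage_subset isOpen_ball
    (hF.preimage_ball_subset_basin n)).trans (kobayashiMetric_le_of_ball_subset hα' hball hnξ)

theorem isShort_basin (hF : IsSuperattracting F a) {b : ℝ} (hab : a < b)
    {x : EuclideanSpace ℂ (Fin k)} (hx : x ∈ basin F) (hxb : ∀ n, b ^ 2 ^ n ≤ ‖flow F n x‖) :
    IsShort (basin F) where
  isOpen := hF.isOpen_basin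
  isConnected := hF.isConnected_basin
  exhaustion := ⟨fun n => flow F n ⁻¹' ball 0 1, hF.isOpen_preimage_ball,
    fun n => hF.monotone_preimage_ball n.le_succ,
    fun n => (hF.isHolomorphicAut_flow n).biholomorphic_preimage _, hF.basin_eq_iUnion⟩
  kobayashi_eq_zero _ hp := hF.kobayashiMetric_basin hp
  sublevel := by
    have hzero : (0 : EuclideanSpace ℂ (Fin k)) ∈ basin F :=
      hF.preimage_ball_subset_basin 0 (mem_ball_self one_pos)
    have hgreen : log b ≤ green F a x := le_ciInf fun n =>
      log_le_potential_of_pow_le (hF.pos.trans hab) ((hxb n).trans (le_max_left _ _))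
    refine ⟨green F a, hF.plurisubharmonicOn_green,
      ⟨log a, fun z => le_ciInf fun n => hF.log_le_potential n z⟩,
      Set.ext fun z => hF.green_neg_iff.symm, 0, hzero, x, hx, ne_of_lt ?_⟩
    exact (hF.green_zero_le.trans_lt (log_lt_log hF.pos hab)).trans_le hgreen

end IsSuperattracting

end Superattracting

section SquareShift

variable {m : ℕ}

/-- The polynomial automorphism `x ↦ (x₀² / 2 + c x₁, …, xₘ₋₁² / 2 + c xₘ, c x₀)` of `ℂᵐ⁺¹`, a small
perturbation of squaring all coordinates but the last. -/
noncomputable def squareShift (c : ℂˣ) :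
    EuclideanSpace ℂ (Fin (m + 1)) ≃ EuclideanSpace ℂ (Fin (m + 1)) where
  toFun x := WithLp.toLp 2
    (Fin.snoc (fun i : Fin m => x i.castSucc ^ 2 / 2 + c * x i.succ) (c * x 0) : Fin (m + 1) → ℂ)
  invFun y := WithLp.toLp 2 <| Fin.induction (motive := fun _ => ℂ) (↑c⁻¹ * y (Fin.last m))
    fun i z => ↑c⁻¹ * (y i.castSucc - z ^ 2 / 2)
  left_inv x := by
    ext j
    induction j using Fin.induction with
    | zero => simp
    | succ i ih => simp_all
  right_inv y := by
    ext j
    induction j using Fin.lastCases <;> simp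

@[simp] lemma squareShift_castSucc (c : ℂˣ) (x : EuclideanSpace ℂ (Fin (m + 1))) (i : Fin m) :
    squareShift c x i.castSucc = x i.castSucc ^ 2 / 2 + c * x i.succ := by
  simp [squareShift]

@[simp] lemma squareShift_last (c : ℂˣ) (x : EuclideanSpace ℂ (Fin (m + 1))) :
    squareShift c x (Fin.last m) = c * x 0 := by
  simp [squareShift]

@[simp] lemma squareShift_symm_zero (c : ℂˣ) (y : EuclideanSpace ℂ (Fin (m + 1))) :
    (squareShift c).symm y 0 = ↑c⁻¹ * y (Fin.last m) := rfl

@[simp] lemma squareShift_symm_succ (c : ℂˣ) (y : EuclideanSpace ℂ (Fin (m + 1))) (i : Fin m) :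
    (squareShift c).symm y i.succ =
      ↑c⁻¹ * (y i.castSucc - (squareShift c).symm y i.castSucc ^ 2 / 2) := rfl

lemma isHolomorphicAut_squareShift (c : ℂˣ) : IsHolomorphicAut (squareShift (m := m) c) := by
  refine ⟨differentiable_euclidean.2 fun j => ?_, differentiable_euclidean.2 fun j => ?_⟩
  · induction j using Fin.lastCases with
    | last => simp only [squareShift_last]; fun_prop
    | cast i => simp only [squareShift_castSucc]; fun_prop
  · induction j using Fin.induction with
    | zero => simp only [squareShift_symm_zero]; fun_prop
    | succ i ih => simp only [squareShift_symm_succ]; fun_prop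

lemma norm_toLp_sq_le {ι : Type*} [Fintype ι] (z : ι → ℂ) :
    ‖WithLp.toLp 2 fun i => z i ^ 2‖ ≤ ‖WithLp.toLp 2 z‖ ^ 2 := by
  rw [EuclideanSpace.norm_sq_eq, EuclideanSpace.norm_eq]
  refine sqrt_le_iff.2 ⟨by positivity, ?_⟩
  simpa only [norm_pow] using
    Finset.sum_sq_le_sq_sum_of_nonneg (s := Finset.univ) fun i _ => sq_nonneg ‖z i‖

lemma norm_squareShift_le (c : ℂˣ) (x : EuclideanSpace ℂ (Fin (m + 1))) :
    ‖squareShift c x‖ ≤ ‖x‖ ^ 2 / 2 + ‖(c : ℂ)‖ * ‖x‖ := by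
  let z : Fin (m + 1) → ℂ := Fin.snoc (fun i : Fin m => x i.castSucc) 0
  let w : Fin (m + 1) → ℂ := Fin.snoc (fun i : Fin m => x i.succ) (x 0)
  have hsplit : squareShift c x =
      (2⁻¹ : ℂ) • WithLp.toLp 2 (fun i => z i ^ 2) + (c : ℂ) • WithLp.toLp 2 w := by
    ext j
    induction j using Fin.lastCases with
    | last => simp [z, w]
    | cast i => simp [z, w, div_eq_inv_mul]
  have hz : ‖WithLp.toLp 2 z‖ ≤ ‖x‖ := by
    rw [EuclideanSpace.norm_eq, EuclideanSpace.norm_eq, Fin.sum_univ_castSucc,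
      Fin.sum_univ_castSucc]
    refine sqrt_le_sqrt ?_
    simp [z]
  have hw : ‖WithLp.toLp 2 w‖ = ‖x‖ := by
    rw [EuclideanSpace.norm_eq, EuclideanSpace.norm_eq, Fin.sum_univ_castSucc, Fin.sum_univ_succ]
    simp [w, add_comm]
  calc ‖squareShift c x‖
      ≤ ‖(2⁻¹ : ℂ) • WithLp.toLp 2 (fun i => z i ^ 2)‖ + ‖(c : ℂ) • WithLp.toLp 2 w‖ :=
        hsplit ▸ norm_add_le _ _
    _ = ‖WithLp.toLp 2 fun i => z i ^ 2‖ / 2 + ‖(c : ℂ)‖ * ‖x‖ := by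
        rw [norm_smul, norm_smul, hw, norm_inv, Complex.norm_ofNat, inv_mul_eq_div]
    _ ≤ ‖x‖ ^ 2 / 2 + ‖(c : ℂ)‖ * ‖x‖ := by
        gcongr
        exact (norm_toLp_sq_le z).trans (by gcongr)

lemma isSuperattracting_squareShift {c : ℕ → ℂˣ} {a : ℝ} (ha : 0 < a) (ha₁ : a < 1)
    (hc : ∀ n, ‖(c n : ℂ)‖ ≤ a ^ 2 ^ n / 2) :
    IsSuperattracting (fun n => squareShift (m := m) (c n)) a where
  pos := ha
  lt_one := ha₁
  isHolomorphicAut n := isHolomorphicAut_squareShift (c n)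
  norm_le n x := by
    have hx : ‖x‖ ≤ max ‖x‖ (a ^ 2 ^ n) := le_max_left _ _
    have hcn : ‖(c n : ℂ)‖ ≤ max ‖x‖ (a ^ 2 ^ n) / 2 :=
      (hc n).trans (div_le_div_of_nonneg_right (le_max_right _ _) two_pos.le)
    calc ‖squareShift (c n) x‖ ≤ ‖x‖ ^ 2 / 2 + ‖(c n : ℂ)‖ * ‖x‖ := norm_squareShift_le _ x
      _ ≤ max ‖x‖ (a ^ 2 ^ n) ^ 2 / 2 + max ‖x‖ (a ^ 2 ^ n) / 2 * max ‖x‖ (a ^ 2 ^ n) := by gcongr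
      _ = max ‖x‖ (a ^ 2 ^ n) ^ 2 := by ring

/-- The region where all coordinates are dominated by the last one, or bounded by `4`. -/
def lastAxisCone (m : ℕ) : Set (EuclideanSpace ℂ (Fin (m + 1))) :=
  {x | ∀ j : Fin m, ‖x j.castSucc‖ < max 4 ‖x (Fin.last m)‖}

lemma mem_lastAxisCone {x : EuclideanSpace ℂ (Fin (m + 1))} :
    x ∈ lastAxisCone m ↔ ∀ j : Fin m, ‖x j.castSucc‖ < max 4 ‖x (Fin.last m)‖ := Iff.rfl

lemma notMem_lastAxisCone {x : EuclideanSpace ℂ (Fin (m + 1))} :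
    x ∉ lastAxisCone m ↔ ∃ j : Fin m, max 4 ‖x (Fin.last m)‖ ≤ ‖x j.castSucc‖ := by
  simp only [mem_lastAxisCone, not_forall, not_lt]

lemma squareShift_notMem_lastAxisCone {c : ℂˣ} (hc : ‖(c : ℂ)‖ ≤ 1)
    {x : EuclideanSpace ℂ (Fin (m + 1))} (hx : x ∉ lastAxisCone m) :
    squareShift c x ∉ lastAxisCone m := by
  obtain ⟨j₀, hj₀⟩ := notMem_lastAxisCone.1 hx
  obtain ⟨j, -, hj⟩ := Finset.exists_max_image Finset.univ (fun i : Fin m => ‖x i.castSucc‖)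
    ⟨j₀, Finset.mem_univ _⟩
  obtain ⟨hfour, hlast⟩ := max_le_iff.1 (hj₀.trans (hj j₀ (Finset.mem_univ _)))
  have hshift : ∀ i, ‖c * x i‖ ≤ ‖x j.castSucc‖ := fun i => by
    rw [norm_mul]
    refine (mul_le_of_le_one_left (norm_nonneg _) hc).trans ?_
    induction i using Fin.lastCases with
    | last => exact hlast
    | cast i => exact hj i (Finset.mem_univ _)
  have hgrow : ‖x j.castSucc‖ ≤ ‖squareShift c x j.castSucc‖ := by
    calc ‖x j.castSucc‖ ≤ ‖x j.castSucc‖ ^ 2 / 2 - ‖x j.castSucc‖ := by nlinarith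
      _ ≤ ‖x j.castSucc ^ 2 / 2‖ - ‖c * x j.succ‖ := by
        rw [norm_div, norm_pow, Complex.norm_ofNat]
        exact sub_le_sub_left (hshift _) _
      _ ≤ ‖squareShift c x j.castSucc‖ := by
        rw [squareShift_castSucc]
        exact norm_sub_le_norm_add _ _
  refine notMem_lastAxisCone.2 ⟨j, max_le (hfour.trans hgrow) ?_⟩
  rw [squareShift_last]
  exact (hshift 0).trans hgrow

lemma basin_squareShift_subset_lastAxisCone {c : ℕ → ℂˣ} (hc : ∀ n, ‖(c n : ℂ)‖ ≤ 1) :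
    basin (fun n => squareShift (c n)) ⊆ lastAxisCone m := by
  intro x hx
  by_contra hxC
  have hflow : ∀ n, flow (fun n => squareShift (c n)) n x ∉ lastAxisCone m := fun n => by
    induction n with
    | zero => exact hxC
    | succ n ih => exact squareShift_notMem_lastAxisCone (hc n) ih
  have hfour : ∀ n, 4 ≤ ‖flow (fun n => squareShift (c n)) n x‖ := fun n => by
    obtain ⟨j, hj⟩ := notMem_lastAxisCone.1 (hflow n)
    exact (le_max_left _ _).trans (hj.trans (PiLp.norm_apply_le _ _))
  have := ge_of_tendsto (tendsto_zero_iff_norm_tendsto_zero.1 hx) (Eventually.of_forall hfour)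
  norm_num at this

open scoped ComplexOrder

variable {c : ℕ → ℂˣ} {x : EuclideanSpace ℂ (Fin (m + 1))}

lemma flow_squareShift_nonneg (hc : ∀ n, 0 ≤ (c n : ℂ)) (hx : ∀ j, 0 ≤ x j) (n : ℕ)
    (j : Fin (m + 1)) : 0 ≤ flow (fun n => squareShift (c n)) n x j := by
  induction n generalizing j with
  | zero => exact hx j
  | succ n ih =>
    rw [flow, Equiv.trans_apply]
    induction j using Fin.lastCases with
    | last => rw [squareShift_last]; exact mul_nonneg (hc n) (ih 0)
    | cast i =>
      rw [squareShift_castSucc]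
      exact add_nonneg (div_nonneg (pow_nonneg (ih _) 2) zero_le_two) (mul_nonneg (hc n) (ih _))

lemma two_mul_pow_le_flow_squareShift (hc : ∀ n, 0 ≤ (c n : ℂ)) (hx : ∀ j, 0 ≤ x j) {z : ℂ}
    (hz : 0 ≤ z) {i : Fin m} (hxi : 2 * z ≤ x i.castSucc) (n : ℕ) :
    2 * z ^ 2 ^ n ≤ flow (fun n => squareShift (c n)) n x i.castSucc := by
  induction n with
  | zero => simpa [flow] using hxi
  | succ n ih =>
    rw [flow, Equiv.trans_apply, squareShift_castSucc]
    calc 2 * z ^ 2 ^ (n + 1) = (2 * z ^ 2 ^ n) ^ 2 / 2 := by ring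
      _ ≤ flow (fun n => squareShift (c n)) n x i.castSucc ^ 2 / 2 := by gcongr
      _ ≤ _ := le_add_of_nonneg_right (mul_nonneg (hc n) (flow_squareShift_nonneg hc hx n _))

lemma isShort_basin_squareShift [NeZero m] {a : ℝ} (ha : 0 < a) (ha₂ : a < 1 / 2)
    (hc₀ : ∀ n, 0 ≤ (c n : ℂ)) (hc : ∀ n, ‖(c n : ℂ)‖ ≤ a ^ 2 ^ n / 2) :
    IsShort (basin fun n => squareShift (m := m) (c n)) := by
  obtain ⟨b, hab, hb⟩ := exists_between ha₂
  have hb₀ : 0 < b := ha.trans hab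
  have hF := isSuperattracting_squareShift (m := m) ha (by linarith) hc
  let x : EuclideanSpace ℂ (Fin (m + 1)) := EuclideanSpace.single (Fin.castSucc 0) (2 * b : ℂ)
  have hx : ∀ j, 0 ≤ x j := fun j => by
    rw [PiLp.single_apply]
    split_ifs
    exacts [mod_cast by positivity, le_rfl]
  have hx_ball : x ∈ ball 0 1 := by
    rw [mem_ball_zero_iff, PiLp.norm_single, norm_mul, Complex.norm_ofNat,
      Complex.norm_of_nonneg hb₀.le]
    linarith
  refine hF.isShort_basin hab (hF.preimage_ball_subset_basin 0 hx_ball) fun n => ?_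
  have hgrow : ((2 * b ^ 2 ^ n : ℝ) : ℂ) ≤
      flow (fun n => squareShift (c n)) n x (Fin.castSucc 0) := by
    simpa using two_mul_pow_le_flow_squareShift hc₀ hx (Complex.zero_le_real.2 hb₀.le)
      (i := 0) (by simp [x]) n
  calc b ^ 2 ^ n ≤ 2 * b ^ 2 ^ n := le_mul_of_one_le_left (by positivity) one_le_two
    _ ≤ (flow (fun n => squareShift (c n)) n x (Fin.castSucc 0)).re :=
      (Complex.le_def.1 hgrow).1
    _ ≤ ‖flow (fun n => squareShift (c n)) n x‖ :=
      (Complex.re_le_norm _).trans (PiLp.norm_apply_le _ _)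

lemma exists_isShort_subset_lastAxisCone (m : ℕ) [NeZero m] :
    ∃ Ω : Set (EuclideanSpace ℂ (Fin (m + 1))), IsShort Ω ∧ Ω ⊆ lastAxisCone m := by
  let a : ℝ := 1 / 4
  let c : ℕ → ℂˣ := fun n => Units.mk0 ((a ^ 2 ^ n / 2 : ℝ) : ℂ) (by norm_cast; positivity)
  have hc : ∀ n, ‖(c n : ℂ)‖ = a ^ 2 ^ n / 2 := fun n => Complex.norm_of_nonneg (by positivity)
  have ha : ∀ n, a ^ 2 ^ n ≤ 1 := fun n => pow_le_one₀ (by positivity) (by norm_num [a])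
  exact ⟨_, isShort_basin_squareShift (by positivity) (by norm_num [a])
    (fun n => Complex.zero_le_real.2 (by positivity)) fun n => (hc n).le,
    basin_squareShift_subset_lastAxisCone (c := c) fun n => by linarith [hc n, ha n]⟩

end SquareShift

lemma IsShort.preimage_affineEquiv {k : ℕ} {Ω : Set (EuclideanSpace ℂ (Fin k))} (hΩ : IsShort Ω)
    (T : EuclideanSpace ℂ (Fin k) ≃ᵃ[ℂ] EuclideanSpace ℂ (Fin k)) : IsShort (T ⁻¹' Ω) := by
  have hT := isHolomorphicAut_affineEquiv T
  obtain ⟨U, hUo, hU, hUb, hΩU⟩ := hΩ.exhaustion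
  obtain ⟨φ, hφ, ⟨c, hc⟩, hφΩ, z, hz, w, hw, hzw⟩ := hΩ.sublevel
  exact
    { isOpen := hT.isOpen_preimage hΩ.isOpen
      isConnected := hT.isConnected_preimage hΩ.isConnected
      exhaustion := ⟨fun j => T ⁻¹' U j, fun j => hT.isOpen_preimage (hUo j),
        fun j => preimage_mono (hU j), fun j => (hT.biholomorphic_preimage _).trans (hUb j),
        by rw [hΩU, preimage_iUnion]⟩
      kobayashi_eq_zero p hp ξ := le_antisymm
        ((hT.kobayashiMetric_le_of_preimage_subset hΩ.isOpen Subset.rfl).trans_eq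
          (hΩ.kobayashi_eq_zero _ hp _)) zero_le
      sublevel := ⟨φ ∘ T, hφ.comp_affineMap T.toAffineMap, ⟨c, fun x => hc (T x)⟩,
        by rw [hφΩ]; rfl, T.symm z, by simpa using hz, T.symm w, by simpa using hw,
        by simpa using hzw⟩ }

section Disjoint

variable {m : ℕ} {i j : Fin m}

/-- The affine automorphism `x ↦ x + 2s xₘ eᵢ + 8s eⱼ`: a shear along the last axis together with a
translation. -/
noncomputable def shearTranslation (i j : Fin m) (s : ℂ) :
    EuclideanSpace ℂ (Fin (m + 1)) ≃ᵃ[ℂ] EuclideanSpace ℂ (Fin (m + 1)) :=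
  (LinearEquiv.transvection (f := (2 * s) • EuclideanSpace.projₗ (Fin.last m))
    (v := EuclideanSpace.single i.castSucc 1) (by simp)).toAffineEquiv.trans
      (AffineEquiv.constVAdd ℂ _ (EuclideanSpace.single j.castSucc (8 * s)))

lemma shearTranslation_last (s : ℂ) (x : EuclideanSpace ℂ (Fin (m + 1))) :
    shearTranslation i j s x (Fin.last m) = x (Fin.last m) := by
  simp [shearTranslation, LinearMap.transvection.apply]

lemma shearTranslation_left (hij : i ≠ j) (s : ℂ) (x : EuclideanSpace ℂ (Fin (m + 1))) :
    shearTranslation i j s x i.castSucc = x i.castSucc + 2 * s * x (Fin.last m) := by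
  simp [shearTranslation, LinearMap.transvection.apply, hij]

lemma shearTranslation_right (hij : i ≠ j) (s : ℂ) (x : EuclideanSpace ℂ (Fin (m + 1))) :
    shearTranslation i j s x j.castSucc = x j.castSucc + 8 * s := by
  simp [shearTranslation, LinearMap.transvection.apply, hij.symm, add_comm]

lemma disjoint_preimage_shearTranslation (hij : i ≠ j) {s t : ℂ} (hst : 1 ≤ ‖s - t‖) :
    Disjoint (shearTranslation i j s ⁻¹' lastAxisCone m)
      (shearTranslation i j t ⁻¹' lastAxisCone m) := by
  -- If `u` is the last coordinate of a common point, the shears contradict `4 ≤ ‖u‖` in the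
  -- `i`-th coordinate, and the translations contradict `‖u‖ ≤ 4` in the `j`-th one.
  refine Set.disjoint_left.2 fun x hs ht => ?_
  set u := x (Fin.last m)
  have hs' : ∀ l : Fin m, ‖shearTranslation i j s x l.castSucc‖ < max 4 ‖u‖ :=
    by simpa only [mem_lastAxisCone, shearTranslation_last] using mem_preimage.1 hs
  have ht' : ∀ l : Fin m, ‖shearTranslation i j t x l.castSucc‖ < max 4 ‖u‖ :=
    by simpa only [mem_lastAxisCone, shearTranslation_last] using mem_preimage.1 ht
  have hclose : ∀ {l : Fin m} {w : ℂ}, (s - t) * w =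
      shearTranslation i j s x l.castSucc - shearTranslation i j t x l.castSucc →
      ‖w‖ < 2 * max 4 ‖u‖ := fun {l w} hw => by
    calc ‖w‖ ≤ ‖(s - t) * w‖ := by
          rw [norm_mul]; exact le_mul_of_one_le_left (norm_nonneg w) hst
      _ ≤ ‖shearTranslation i j s x l.castSucc‖ + ‖shearTranslation i j t x l.castSucc‖ :=
        hw ▸ norm_sub_le _ _
      _ < 2 * max 4 ‖u‖ := by linarith [hs' l, ht' l]
  have hi : ‖2 * u‖ < 2 * max 4 ‖u‖ := hclose (l := i) (by
    rw [shearTranslation_left hij, shearTranslation_left hij]; ring)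
  have hj : ‖(8 : ℂ)‖ < 2 * max 4 ‖u‖ := hclose (l := j) (by
    rw [shearTranslation_right hij, shearTranslation_right hij]; ring)
  rw [norm_mul, Complex.norm_ofNat] at hi
  rw [Complex.norm_ofNat] at hj
  rcases max_cases 4 ‖u‖ with ⟨h, -⟩ | ⟨h, -⟩ <;> linarith

end Disjoint

end ShortCk

theorem theorem1p3_general (k : ℕ) (hk : 3 ≤ k) :
    ∃ Ω : ℕ → Set (EuclideanSpace ℂ (Fin k)),
      (∀ n, ShortCk.IsShort (Ω n)) ∧ Pairwise fun i j => Disjoint (Ω i) (Ω j) := by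
  obtain ⟨m, rfl⟩ := Nat.exists_eq_add_of_le' hk
  obtain ⟨Ω, hΩ, hcone⟩ := ShortCk.exists_isShort_subset_lastAxisCone (m + 2)
  refine ⟨fun n => ShortCk.shearTranslation 0 1 (n : ℂ) ⁻¹' Ω,
    fun n => hΩ.preimage_affineEquiv _, fun i j hij => ?_⟩
  have hdist : 1 ≤ ‖(i : ℂ) - j‖ := by
    rw [← dist_eq_norm, ← Complex.ofReal_natCast, ← Complex.ofReal_natCast,
      Complex.isometry_ofReal.dist_eq, Nat.dist_cast_real]
    exact Nat.pairwise_one_le_dist hij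
  exact (ShortCk.disjoint_preimage_shearTranslation Fin.zero_ne_one hdist).mono
    (Set.preimage_mono hcone) (Set.preimage_mono hcone)

theorem theorem1p3 (k : ℕ) (hk : 3 ≤ k) :
    ∃ Ω : Fin (k - 1) → Set (EuclideanSpace ℂ (Fin k)),
      (∀ i, ShortCk.IsShort (Ω i)) ∧ ∀ i j, i ≠ j → Ω i ∩ Ω j = ∅ := by
  obtain ⟨Ω, hΩ, hdisj⟩ := theorem1p3_general k hk
  exact ⟨fun i => Ω i, fun i => hΩ i, fun i j hij => (hdisj (Fin.val_ne_of_ne hij)).inter_eq⟩
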